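/- Let $E$ be a real Banach space with $\dim E\ge 2$. For a closed convex set $A\subset E$ and $\varepsilon>0$ put $$\delta_A(\varepsilon)=\sup\Bigl\{\delta\ge 0 \;\Big|\; B_\delta\bigl(\tfrac{x_1+x_2}{2}\bigr)\subset A \ \text{ for all } x_1,x_2\in A \text{ with } \|x_1-x_2\|=\varepsilon\Bigr\}\in[0,\infty],$$ where $B_r(x)$ is the closed ball with center $x$ and radius $r$; $A$ is called uniformly convex if $\delta_A(\varepsilon)>0$ for all $\varepsilon\in(0,\operatorname{diam}A)$. Let $A\subset E$ be closed, convex and uniformly convex with $\operatorname{diam}A=1$, and let $r_0>0$ and $a\in E$ be such that $B_{r_0}(a)\subset A$. Then for all $\varepsilon\in(0,1)$ $$\delta_A(2r_0\varepsilon)\le \tfrac12\bigl(1-\sqrt{1-\varepsilon^2}\bigr).$$ Equality is attained for the Euclidean ball: if $H$ is a real inner product space with $\dim H\ge 2$ and $A=B_{1/2}(c)$ for some $c\in H$, then $A$ is uniformly convex with $\operatorname{diam}A=1$, and with $r_0=\tfrac12$ one has $\delta_A(2r_0\varepsilon)=\tfrac12\bigl(1-\sqrt{1-\varepsilon^2}\bigr)$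 for all $\varepsilon\in(0,1)$. -/

import Mathlib

open scoped ENNReal

section UniformlyConvexSets

variable {E : Type*} [NormedAddCommGroup E] [NormedSpace ℝ E]

/-- The modulus of convexity of a (closed convex) set `A` at `ε`: the supremum of all `δ ≥ 0` such
that for all `x₁, x₂ ∈ A` with `‖x₁ - x₂‖ = ε` the closed ball of radius `δ` about the midpoint
`(x₁ + x₂) / 2` is contained in `A`.  The supremum is taken in `[0, ∞]`, so that it is
meaningful for every set `A`, also when the admissible `δ` are unbounded (as for `A = E`). -/
noncomputable def modulusOfConvexity (A : Set E) (ε : ℝ) : ℝ≥0∞ :=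
  sSup (ENNReal.ofReal '' {δ : ℝ | 0 ≤ δ ∧ ∀ x₁ ∈ A, ∀ x₂ ∈ A, ‖x₁ - x₂‖ = ε →
    Metric.closedBall ((1 / 2 : ℝ) • (x₁ + x₂)) δ ⊆ A})

/-- A closed convex set is uniformly convex if its modulus of convexity is strictly positive at
every `ε` in the open interval `(0, diam A)`, where `diam A ∈ [0, ∞]`. -/
structure IsUniformlyConvexSet (A : Set E) : Prop where
  isClosed : IsClosed A
  convex : Convex ℝ A
  modulus_pos : ∀ ε : ℝ, 0 < ε → ENNReal.ofReal ε < Metric.ediam A → 0 < modulusOfConvexity A ε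

end UniformlyConvexSets

/-!
The upper bound is an area argument in a plane section of `A` through `a`. Let `B` be the unit ball
of the norm in that plane, put `ρ = r₀ ε`, and let `δ` be admissible for chords of length `2 ρ`. All
midpoints of such chords lie in the set `K` of points `m` with `m + δ B ⊆ A`.

A point `m ∈ A` that is not the midpoint of a chord of length `2 ρ` is the midpoint of a chord with
ends on the boundary and half-vector in the interior of `ρ B`. For `x, y` running over the boundary
curve, the maps `(x, y) ↦ (x + y) / 2` and `(x, y) ↦ (y - x) / 2` have the same Jacobian up to sign,
so midpoints of such chords fill no more area than their half-vectors do, once every half-vector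
comes from a single chord (`volume_image_midpoint_le`). This holds if chords are oriented so as to
have `a` on their left, because the chord through `a` in the same direction has length at least
`2 r₀ > 2 ρ` (`StrictConvex.eq_of_parallel_chords`). Hence the exceptional points have area at most
`ρ² |B|` (`volume_not_midpoint_le`), and `r₀ B + a ⊆ A` gives `|K| ≥ |A| - ρ² |B| ≥ (1 - ε²) |A|`.

On the other hand `K + δ B ⊆ A`, and `A - A ⊆ B` since `A` has diameter `1`. The planar
Brunn–Minkowski inequality (`sqrt_volume_add_sqrt_volume_le`, proved by slicing) turns these
inclusions into `√|K| + δ √|B| ≤ √|A|` and `2 √|A| ≤ √|B|`. Together, `√(1 - ε²) + 2 δ ≤ 1`.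

For a Euclidean ball of radius `1 / 2` the reverse inequality is the parallelogram law.
-/

open MeasureTheory Set
open scoped ENNReal Pointwise

/-! ### The planar Brunn–Minkowski inequality -/

/-- The one-dimensional Brunn–Minkowski inequality for compact sets: with `M = max U` and
`m = min V`, the translates `U + m` and `M + V` lie in `U + V` and meet only in `M + m`. -/
theorem volume_add_volume_le_of_isCompact {U V : Set ℝ} (hU : IsCompact U) (hV : IsCompact V)
    (hU' : U.Nonempty) (hV' : V.Nonempty) : volume U + volume V ≤ volume (U + V) := by
  obtain ⟨M, hM, hMax⟩ := hU.exists_isGreatest hU'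
  obtain ⟨m, hm, hMin⟩ := hV.exists_isLeast hV'
  have h1 : volume ((fun x => m + x) '' U) = volume U := by simp
  have h2 : volume ((fun x => M + x) '' V) = volume V := by simp
  have hd : AEDisjoint volume ((fun x => m + x) '' U) ((fun x => M + x) '' V) := by
    refine measure_mono_null (t := {M + m}) ?_ (by simp)
    rintro z ⟨⟨x, hx, rfl⟩, ⟨y, hy, hxy⟩⟩
    have := hMax hx
    have := hMin hy
    simp only [mem_singleton_iff] at *
    linarith
  have hmV : MeasurableSet ((fun x => M + x) '' V) :=
    (hV.image (by fun_prop)).measurableSet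
  calc volume U + volume V
      = volume ((fun x => m + x) '' U ∪ (fun x => M + x) '' V) := by
        rw [measure_union₀ hmV.nullMeasurableSet hd, h1, h2]
    _ ≤ volume (U + V) := by
        refine measure_mono ?_
        rintro z (⟨x, hx, rfl⟩ | ⟨y, hy, rfl⟩)
        · exact ⟨x, hx, m, hm, add_comm _ _⟩
        · exact ⟨M, hM, y, hy, rfl⟩

/-- The one-dimensional Brunn–Minkowski inequality. -/
theorem volume_add_volume_le {U V : Set ℝ} (hU : MeasurableSet U) (hV : MeasurableSet V)
    (hU' : U.Nonempty) (hV' : V.Nonempty) : volume U + volume V ≤ volume (U + V) := by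
  obtain ⟨u, hu⟩ := hU'
  obtain ⟨v, hv⟩ := hV'
  rw [hU.measure_eq_iSup_isCompact, hV.measure_eq_iSup_isCompact]
  simp only [iSup_and']
  -- Adding one point to each compact set makes both of them non-empty.
  refine ENNReal.biSup_add_biSup_le' (p := fun K => K ⊆ U ∧ IsCompact K) (q := fun L => L ⊆ V ∧ IsCompact L)
    ⟨∅, by simp⟩ ⟨∅, by simp⟩ ?_
  rintro K ⟨hKU, hK⟩ L ⟨hLV, hL⟩
  calc volume K + volume L ≤ volume (insert u K) + volume (insert v L) :=
        add_le_add (measure_mono (subset_insert _ _)) (measure_mono (subset_insert _ _))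
    _ ≤ volume (insert u K + insert v L) :=
        volume_add_volume_le_of_isCompact (hK.insert u) (hL.insert v) ⟨u, by simp⟩ ⟨v, by simp⟩
    _ ≤ volume (U + V) :=
        measure_mono (add_subset_add (insert_subset hu hKU) (insert_subset hv hLV))

/-- The layer-cake formula for a function with values in `[0, 1]`. -/
theorem lintegral_ofReal_eq_lintegral_Ioo {f : ℝ → ℝ} (hf : Measurable f) (h0 : ∀ x, 0 ≤ f x)
    (h1 : ∀ x, f x ≤ 1) :
    ∫⁻ x, ENNReal.ofReal (f x) = ∫⁻ t in Ioo (0 : ℝ) 1, volume {x | t < f x} := by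
  rw [lintegral_eq_lintegral_meas_lt volume (Filter.Eventually.of_forall h0) hf.aemeasurable,
    ← Ioo_union_Ici_eq_Ioi (zero_lt_one' ℝ), lintegral_union measurableSet_Ici]
  · have : ∫⁻ t in Ici (1 : ℝ), volume {x | t < f x} = 0 := by
      rw [setLIntegral_congr_fun (g := fun _ => 0) measurableSet_Ici]
      · simp
      · intro t ht
        have : {x | t < f x} = ∅ := by
          ext x
          simpa using (h1 x).trans ht
        simp [this]
    rw [this, add_zero]
  · exact Set.disjoint_left.2 fun x hx hx' => absurd hx.2 (not_lt.2 hx')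

/-- A Prékopa–Leindler-type inequality for functions normalised by their suprema `a` and `b`: the
superlevel set of `h` at height `(a + b) τ` contains the sum of those of `f` at `a τ` and of `g` at
`b τ`, so integrating the one-dimensional Brunn–Minkowski inequality over `τ ∈ (0, 1)` gives it. -/
theorem lintegral_div_add_lintegral_div_le {f g h : ℝ → ℝ} {a b : ℝ} (ha : 0 < a) (hb : 0 < b)
    (hf : Measurable f) (hg : Measurable g) (hh : Measurable h)
    (hf0 : ∀ x, 0 ≤ f x) (hg0 : ∀ x, 0 ≤ g x) (hh0 : ∀ x, 0 ≤ h x)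
    (hfa : IsLUB (range f) a) (hgb : IsLUB (range g) b)
    (hfg : ∀ x y, 0 < f x → 0 < g y → f x + g y ≤ h (x + y)) :
    (∫⁻ x, ENNReal.ofReal (f x / a)) + ∫⁻ x, ENNReal.ofReal (g x / b) ≤
      ∫⁻ x, ENNReal.ofReal (h x / (a + b)) := by
  have hab : 0 < a + b := by positivity
  rw [lintegral_ofReal_eq_lintegral_Ioo (hf.div_const a) (fun x => div_nonneg (hf0 x) ha.le)
      (fun x => (div_le_one ha).2 (hfa.1 ⟨x, rfl⟩)),
    lintegral_ofReal_eq_lintegral_Ioo (hg.div_const b) (fun x => div_nonneg (hg0 x) hb.le)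
      (fun x => (div_le_one hb).2 (hgb.1 ⟨x, rfl⟩)),
    lintegral_eq_lintegral_meas_lt (f := fun x => h x / (a + b)) volume
      (Filter.Eventually.of_forall fun x => div_nonneg (hh0 x) hab.le)
      (hh.div_const _).aemeasurable]
  have hmeas : Measurable fun t : ℝ => volume {x | t < f x / a} :=
    (show Antitone fun t : ℝ => volume {x | t < f x / a} from
      fun s t hst => measure_mono fun x hx => lt_of_le_of_lt hst hx).measurable
  rw [← lintegral_add_left hmeas]
  refine (setLIntegral_mono' measurableSet_Ioo ?_).trans (lintegral_mono_set Ioo_subset_Ioi_self)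
  rintro t ⟨ht0, ht1⟩
  have nonempty_of_isLUB : ∀ {k : ℝ → ℝ} {c : ℝ}, 0 < c → IsLUB (range k) c →
      {x | t < k x / c}.Nonempty := by
    intro k c hc hk
    obtain ⟨_, ⟨x, rfl⟩, hx, -⟩ := hk.exists_between (show t * c < c by nlinarith)
    exact ⟨x, (lt_div_iff₀ hc).2 hx⟩
  refine (volume_add_volume_le (measurableSet_lt measurable_const (hf.div_const a))
    (measurableSet_lt measurable_const (hg.div_const b))
    (nonempty_of_isLUB ha hfa) (nonempty_of_isLUB hb hgb)).trans (measure_mono ?_)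
  rintro _ ⟨x, hx, y, hy, rfl⟩
  simp only [mem_ofPred_eq] at hx hy ⊢
  rw [lt_div_iff₀ ha] at hx
  rw [lt_div_iff₀ hb] at hy
  rw [lt_div_iff₀ hab]
  have := hfg x y ((by positivity : 0 < t * a).trans hx) ((by positivity : 0 < t * b).trans hy)
  linarith

/-- The length of the vertical section of a planar set at abscissa `x`. -/
noncomputable def sectionLength (K : Set (ℝ × ℝ)) (x : ℝ) : ℝ :=
  volume.real (Prod.mk x ⁻¹' K)

theorem sectionLength_nonneg (K : Set (ℝ × ℝ)) (x : ℝ) : 0 ≤ sectionLength K x :=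
  measureReal_nonneg

theorem isCompact_section {K : Set (ℝ × ℝ)} (hK : IsCompact K) (x : ℝ) :
    IsCompact (Prod.mk x ⁻¹' K) :=
  (hK.image continuous_snd).of_isClosed_subset (hK.isClosed.preimage (by fun_prop))
    fun y hy => ⟨(x, y), hy, rfl⟩

theorem measurable_sectionLength {K : Set (ℝ × ℝ)} (hK : IsCompact K) :
    Measurable (sectionLength K) :=
  (measurable_measure_prodMk_left hK.measurableSet).ennreal_toReal

theorem volume_eq_lintegral_sectionLength {K : Set (ℝ × ℝ)} (hK : IsCompact K) :
    volume K = ∫⁻ x, ENNReal.ofReal (sectionLength K x) := by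
  rw [Measure.volume_eq_prod, Measure.prod_apply hK.measurableSet]
  refine lintegral_congr fun x => ?_
  rw [sectionLength, ofReal_measureReal (isCompact_section hK x).measure_lt_top.ne]

theorem bddAbove_range_sectionLength {K : Set (ℝ × ℝ)} (hK : IsCompact K) :
    BddAbove (range (sectionLength K)) := by
  refine ⟨volume.real (Prod.snd '' K), ?_⟩
  rintro _ ⟨x, rfl⟩
  have hsub : Prod.mk x ⁻¹' K ⊆ Prod.snd '' K := fun y hy => ⟨(x, y), hy, rfl⟩
  exact measureReal_mono hsub ((hK.image continuous_snd).measure_lt_top (μ := volume)).ne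

theorem iSup_sectionLength_pos {K : Set (ℝ × ℝ)} (hK : IsCompact K) (h : 0 < volume K) :
    0 < ⨆ x, sectionLength K x := by
  by_contra! hle
  have : ∀ x, sectionLength K x = 0 := fun x =>
    le_antisymm ((le_ciSup (bddAbove_range_sectionLength hK) x).trans hle)
      (sectionLength_nonneg K x)
  rw [volume_eq_lintegral_sectionLength hK] at h
  simp [this] at h

theorem sectionLength_add_le {K L : Set (ℝ × ℝ)} (hK : IsCompact K) (hL : IsCompact L) (x y : ℝ)
    (hx : 0 < sectionLength K x) (hy : 0 < sectionLength L y) :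
    sectionLength K x + sectionLength L y ≤ sectionLength (K + L) (x + y) := by
  have ne_of_pos : ∀ {M : Set (ℝ × ℝ)} {z : ℝ}, 0 < sectionLength M z →
      (Prod.mk z ⁻¹' M).Nonempty := by
    intro M z hz
    by_contra hne
    rw [not_nonempty_iff_eq_empty] at hne
    simp [sectionLength, hne] at hz
  have key := volume_add_volume_le_of_isCompact (isCompact_section hK x) (isCompact_section hL y)
    (ne_of_pos hx) (ne_of_pos hy)
  have hfin := ((isCompact_section (hK.add hL) (x + y)).measure_lt_top (μ := volume)).ne
  have hsub : Prod.mk x ⁻¹' K + Prod.mk y ⁻¹' L ⊆ Prod.mk (x + y) ⁻¹' (K + L) := by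
    rintro _ ⟨s, hs, t, ht, rfl⟩
    exact ⟨(x, s), hs, (y, t), ht, rfl⟩
  unfold sectionLength Measure.real
  rw [← ENNReal.toReal_add (isCompact_section hK x).measure_lt_top.ne
    (isCompact_section hL y).measure_lt_top.ne]
  exact ENNReal.toReal_mono hfin (key.trans (measure_mono hsub))

/-- The Brunn–Minkowski inequality in the plane. If `a` and `b` are the maximal lengths of vertical
sections, Bonnesen's form `|K + L| ≥ (a + b) (|K| / a + |L| / b)` implies it. -/
theorem sqrt_volume_add_sqrt_volume_le {K L : Set (ℝ × ℝ)} (hK : IsCompact K) (hL : IsCompact L)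
    (hK0 : 0 < volume K) (hL0 : 0 < volume L) :
    √(volume.real K) + √(volume.real L) ≤ √(volume.real (K + L)) := by
  set a := ⨆ x, sectionLength K x
  set b := ⨆ x, sectionLength L x
  have ha : 0 < a := iSup_sectionLength_pos hK hK0
  have hb : 0 < b := iSup_sectionLength_pos hL hL0
  have hKL := hK.add hL
  have key := lintegral_div_add_lintegral_div_le ha hb (measurable_sectionLength hK)
    (measurable_sectionLength hL) (measurable_sectionLength hKL) (sectionLength_nonneg K)
    (sectionLength_nonneg L) (sectionLength_nonneg (K + L))
    (isLUB_ciSup (bddAbove_range_sectionLength hK)) (isLUB_ciSup (bddAbove_range_sectionLength hL))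
    (sectionLength_add_le hK hL)
  have hdiv : ∀ {M : Set (ℝ × ℝ)} {c : ℝ}, IsCompact M → 0 < c →
      ∫⁻ x, ENNReal.ofReal (sectionLength M x / c) = ENNReal.ofReal (volume.real M / c) := by
    intro M c hM hc
    simp_rw [div_eq_mul_inv, ENNReal.ofReal_mul' (inv_nonneg.2 hc.le)]
    rw [lintegral_mul_const _ (measurable_sectionLength hM).ennreal_ofReal,
      ← volume_eq_lintegral_sectionLength hM, ofReal_measureReal hM.measure_lt_top.ne]
  rw [hdiv hK ha, hdiv hL hb, hdiv hKL (by positivity),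
    ← ENNReal.ofReal_add (by positivity) (by positivity),
    ENNReal.ofReal_le_ofReal_iff (by positivity)] at key
  have hX : 0 ≤ volume.real K := measureReal_nonneg
  have hY : 0 ≤ volume.real L := measureReal_nonneg
  generalize volume.real K = X at key hX ⊢
  generalize volume.real L = Y at key hY ⊢
  obtain ⟨x, hx, rfl⟩ : ∃ x, 0 ≤ x ∧ x ^ 2 = X := ⟨√X, by positivity, Real.sq_sqrt hX⟩
  obtain ⟨y, hy, rfl⟩ : ∃ y, 0 ≤ y ∧ y ^ 2 = Y := ⟨√Y, by positivity, Real.sq_sqrt hY⟩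
  refine Real.le_sqrt_of_sq_le ?_
  rw [Real.sqrt_sq hx, Real.sqrt_sq hy]
  rw [le_div_iff₀ (by positivity)] at key
  refine le_trans ?_ key
  have : (x ^ 2 / a + y ^ 2 / b) * (a + b) - (x + y) ^ 2 = (x * b - y * a) ^ 2 / (a * b) := by
    field_simp
    ring
  have : 0 ≤ (x * b - y * a) ^ 2 / (a * b) := by positivity
  linarith

/-! ### Midpoints and half-differences along a Lipschitz curve -/

theorem LipschitzWith.volume_image_eq_zero {f : ℝ × ℝ → ℝ × ℝ} {C : NNReal}
    (hf : LipschitzWith C f) {s : Set (ℝ × ℝ)} (hs : volume s = 0) : volume (f '' s) = 0 := by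
  rw [← hausdorffMeasure_prod_real] at hs ⊢
  have := hf.hausdorffMeasure_image_le (d := 2) (by norm_num) s
  rw [hs, mul_zero] at this
  exact le_antisymm this bot_le

/-- For a planar Lipschitz curve `x`, the maps `(s, t) ↦ (x s + x t) / 2` and
`(s, t) ↦ (x t - x s) / 2` have the same Jacobian up to sign: their derivatives differ by the
reflection `(s, t) ↦ (-s, t)`. Hence the set of midpoints of a family of chords has at most the
area of the set of half-chord vectors, provided each vector comes from a single chord. -/
theorem volume_image_midpoint_le {x : ℝ → ℝ × ℝ} {C : NNReal} (hx : LipschitzWith C x)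
    {P : Set (ℝ × ℝ)} (hP : MeasurableSet P)
    (hinj : InjOn (fun z : ℝ × ℝ => (1 / 2 : ℝ) • (x z.2 - x z.1)) P) :
    volume ((fun z : ℝ × ℝ => (1 / 2 : ℝ) • (x z.1 + x z.2)) '' P) ≤
      volume ((fun z : ℝ × ℝ => (1 / 2 : ℝ) • (x z.2 - x z.1)) '' P) := by
  set m : ℝ × ℝ → ℝ × ℝ := fun z => (1 / 2 : ℝ) • (x z.1 + x z.2) with hm
  set v : ℝ × ℝ → ℝ × ℝ := fun z => (1 / 2 : ℝ) • (x z.2 - x z.1) with hv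
  set S : Set ℝ := {t | DifferentiableAt ℝ x t}
  have hS : MeasurableSet S := measurableSet_of_differentiableAt ℝ x
  have hS0 : volume Sᶜ = 0 := hx.ae_differentiableAt_real
  set G : Set (ℝ × ℝ) := S ×ˢ S
  have hG : MeasurableSet G := hS.prod hS
  have hG0 : volume Gᶜ = 0 := by
    rw [compl_prod_eq_union]
    refine measure_union_null ?_ ?_ <;> rw [Measure.volume_eq_prod, Measure.prod_prod] <;> simp [hS0]
  have hmL : LipschitzWith (‖(1 / 2 : ℝ)‖₊ * (C * 1 + C * 1)) m :=
    (lipschitzWith_smul (1 / 2 : ℝ)).comp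
      ((hx.comp LipschitzWith.prod_fst).add (hx.comp LipschitzWith.prod_snd))
  let m' : ℝ × ℝ → (ℝ × ℝ →L[ℝ] ℝ × ℝ) := fun z =>
    (1 / 2 : ℝ) • ((ContinuousLinearMap.fst ℝ ℝ ℝ).smulRight (deriv x z.1) +
      (ContinuousLinearMap.snd ℝ ℝ ℝ).smulRight (deriv x z.2))
  let R : ℝ × ℝ →L[ℝ] ℝ × ℝ :=
    (-ContinuousLinearMap.fst ℝ ℝ ℝ).prod (ContinuousLinearMap.snd ℝ ℝ ℝ)
  have hRdet : |R.det| = 1 := by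
    have hRR : (R : ℝ × ℝ →ₗ[ℝ] ℝ × ℝ) * (R : ℝ × ℝ →ₗ[ℝ] ℝ × ℝ) = 1 := by
      ext <;> simp [R]
    have h1 : R.det * R.det = 1 := by
      have := congrArg LinearMap.det hRR
      rwa [map_mul, map_one] at this
    rcases mul_self_eq_one_iff.1 h1 with h | h <;> simp [h]
  have hdm : ∀ z ∈ P ∩ G, HasFDerivWithinAt m (m' z) (P ∩ G) z := by
    rintro z ⟨-, h1, h2⟩
    have e1 := (DifferentiableAt.hasDerivAt h1).hasFDerivAt.comp z
      (hasFDerivAt_fst (𝕜 := ℝ) (p := z))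
    have e2 := (DifferentiableAt.hasDerivAt h2).hasFDerivAt.comp z
      (hasFDerivAt_snd (𝕜 := ℝ) (p := z))
    refine (HasFDerivAt.congr_fderiv (f := m) ((e1.add e2).const_smul (1 / 2 : ℝ))
      ?_).hasFDerivWithinAt
    ext <;> simp [m']
  have hdv : ∀ z ∈ P ∩ G, HasFDerivWithinAt v ((m' z).comp R) (P ∩ G) z := by
    rintro z ⟨-, h1, h2⟩
    have e1 := (DifferentiableAt.hasDerivAt h1).hasFDerivAt.comp z
      (hasFDerivAt_fst (𝕜 := ℝ) (p := z))
    have e2 := (DifferentiableAt.hasDerivAt h2).hasFDerivAt.comp z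
      (hasFDerivAt_snd (𝕜 := ℝ) (p := z))
    refine (HasFDerivAt.congr_fderiv (f := v) ((e2.sub e1).const_smul (1 / 2 : ℝ))
      ?_).hasFDerivWithinAt
    ext <;> simp [m', R]
  have hdet : ∀ z, |((m' z).comp R).det| = |(m' z).det| := by
    intro z
    have : ((m' z).comp R).det = (m' z).det * R.det := LinearMap.det_comp _ _
    rw [this, abs_mul, hRdet, mul_one]
  have hPG : MeasurableSet (P ∩ G) := hP.inter hG
  calc volume (m '' P) ≤ volume (m '' (P ∩ G) ∪ m '' Gᶜ) := by
        rw [← image_union]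
        refine measure_mono (image_mono fun z hz => ?_)
        by_cases h : z ∈ G
        · exact Or.inl ⟨hz, h⟩
        · exact Or.inr h
    _ ≤ volume (m '' (P ∩ G)) + volume (m '' Gᶜ) := measure_union_le _ _
    _ = volume (m '' (P ∩ G)) := by rw [hmL.volume_image_eq_zero hG0, add_zero]
    _ ≤ ∫⁻ z in P ∩ G, ENNReal.ofReal |(m' z).det| :=
        addHaar_image_le_lintegral_abs_det_fderiv volume hPG hdm
    _ = ∫⁻ z in P ∩ G, ENNReal.ofReal |((m' z).comp R).det| := by simp_rw [hdet]
    _ = volume (v '' (P ∩ G)) :=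
        lintegral_abs_det_fderiv_eq_addHaar_image volume hPG hdv (hinj.mono inter_subset_left)
    _ ≤ volume (v '' P) := measure_mono (image_mono inter_subset_left)

/-! ### Polar parametrization of the boundary of a planar convex body -/

/-- The point of the Euclidean unit circle at angle `θ`. -/
noncomputable def circlePoint (θ : ℝ) : ℝ × ℝ := (Real.cos θ, Real.sin θ)

theorem circlePoint_ne_zero (θ : ℝ) : circlePoint θ ≠ 0 := by
  intro h
  have h1 := congrArg Prod.fst h
  have h2 := congrArg Prod.snd h
  have := Real.sin_sq_add_cos_sq θ
  simp only [circlePoint, Prod.fst_zero, Prod.snd_zero] at h1 h2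
  simp [h1, h2] at this

theorem continuous_circlePoint : Continuous circlePoint :=
  Real.continuous_cos.prodMk Real.continuous_sin

theorem lipschitzWith_circlePoint : LipschitzWith 1 circlePoint := by
  have := Real.lipschitzWith_cos.prodMk Real.lipschitzWith_sin
  rwa [max_self] at this

theorem norm_circlePoint_le (θ : ℝ) : ‖circlePoint θ‖ ≤ 1 :=
  max_le (Real.abs_cos_le_one θ) (Real.abs_sin_le_one θ)

theorem exists_eq_smul_circlePoint {z : ℝ × ℝ} (hz : z ≠ 0) :
    ∃ r > 0, ∃ θ ∈ Ioc (-Real.pi) Real.pi, z = (r : ℝ) • circlePoint θ := by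
  set w : ℂ := ⟨z.1, z.2⟩ with hw
  have hw0 : w ≠ 0 := by
    intro h
    exact hz (Prod.ext (congrArg Complex.re h) (congrArg Complex.im h))
  refine ⟨‖w‖, norm_pos_iff.2 hw0, w.arg, Complex.arg_mem_Ioc w, ?_⟩
  ext
  · simp [circlePoint, Complex.norm_mul_cos_arg, hw]
  · simp [circlePoint, Complex.norm_mul_sin_arg, hw]

/-- The boundary of a convex body around the origin in polar coordinates: the radial function is the
inverse of the gauge. -/
noncomputable def boundaryPoint (A : Set (ℝ × ℝ)) (θ : ℝ) : ℝ × ℝ :=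
  (gauge A (circlePoint θ))⁻¹ • circlePoint θ

section Boundary

variable {A : Set (ℝ × ℝ)}

theorem gauge_pos_of_isCompact (hA : IsCompact A) (h0 : A ∈ nhds 0) {z : ℝ × ℝ} (hz : z ≠ 0) :
    0 < gauge A z :=
  (gauge_pos (absorbent_nhds_zero h0) (NormedSpace.isVonNBounded_iff ℝ |>.2 hA.isBounded)).2 hz

theorem exists_lipschitzWith_boundaryPoint (hA : IsCompact A) (hc : Convex ℝ A)
    (h0 : A ∈ nhds 0) : ∃ C, LipschitzWith C (boundaryPoint A) := by
  obtain ⟨K, hK⟩ := hc.lipschitz_gauge h0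
  obtain ⟨R, hR0, hR⟩ : ∃ R > 0, ∀ z ∈ A, ‖z‖ ≤ R := hA.isBounded.exists_pos_norm_le
  -- `A` lies in the ball of radius `R`, so its gauge is at least `‖·‖ / R`, and the sup norm of
  -- a point of the circle is at least `1 / 2`.
  have hlow : ∀ θ, 1 / (2 * R) ≤ gauge A (circlePoint θ) := by
    intro θ
    have h1 : gauge (Metric.closedBall (0 : ℝ × ℝ) R) (circlePoint θ) ≤ gauge A (circlePoint θ) :=
      gauge_mono (absorbent_nhds_zero h0) (fun z hz => by simpa using hR z hz) _
    rw [gauge_closedBall hR0.le] at h1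
    refine le_trans ?_ h1
    rw [div_le_div_iff₀ (by positivity) hR0]
    have h2 : (1 : ℝ) / 2 ≤ ‖circlePoint θ‖ := by
      by_contra! hlt
      have hcos := (le_max_left _ _).trans_lt hlt
      have hsin := (le_max_right _ _).trans_lt hlt
      simp only [circlePoint, Real.norm_eq_abs, abs_lt] at hcos hsin
      nlinarith [Real.sin_sq_add_cos_sq θ]
    nlinarith
  set c := 1 / (2 * R)
  have hc0 : 0 < c := by positivity
  refine ⟨Real.toNNReal (1 / c + K / c ^ 2), LipschitzWith.of_dist_le_mul fun s t => ?_⟩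
  rw [Real.coe_toNNReal _ (by positivity), dist_eq_norm (boundaryPoint A s)]
  have hs := hlow s
  have ht := hlow t
  have hg : |gauge A (circlePoint t) - gauge A (circlePoint s)| ≤ K * dist s t := by
    rw [← Real.dist_eq, dist_comm]
    refine (hK.dist_le_mul _ _).trans ?_
    have := lipschitzWith_circlePoint.dist_le_mul s t
    rw [NNReal.coe_one, one_mul] at this
    gcongr
  have hu : ‖circlePoint s - circlePoint t‖ ≤ dist s t := by
    have := lipschitzWith_circlePoint.dist_le_mul s t
    rwa [NNReal.coe_one, one_mul, dist_eq_norm] at this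
  have hv := norm_circlePoint_le t
  simp only [boundaryPoint]
  generalize gauge A (circlePoint s) = a at *
  generalize gauge A (circlePoint t) = b at *
  have ha : 0 < a := hc0.trans_le hs
  have hb : 0 < b := hc0.trans_le ht
  have hsplit : a⁻¹ • circlePoint s - b⁻¹ • circlePoint t =
      a⁻¹ • (circlePoint s - circlePoint t) + ((b - a) / (a * b)) • circlePoint t := by
    have : (b - a) / (a * b) = a⁻¹ - b⁻¹ := by field_simp
    rw [this]
    module
  rw [hsplit]
  refine (norm_add_le _ _).trans ?_
  rw [norm_smul, norm_smul, Real.norm_eq_abs, Real.norm_eq_abs, abs_div, abs_of_pos (inv_pos.2 ha),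
    abs_of_pos (mul_pos ha hb)]
  have e1 : a⁻¹ * ‖circlePoint s - circlePoint t‖ ≤ 1 / c * dist s t := by
    rw [← one_div]
    gcongr
  have e2 : |b - a| / (a * b) * ‖circlePoint t‖ ≤ K * dist s t / c ^ 2 * 1 := by
    have : c ^ 2 ≤ a * b := by nlinarith
    gcongr
  calc _ ≤ 1 / c * dist s t + K * dist s t / c ^ 2 * 1 := add_le_add e1 e2
    _ = (1 / c + K / c ^ 2) * dist s t := by ring

theorem boundaryPoint_mem_frontier (hA : IsCompact A) (hc : Convex ℝ A) (h0 : A ∈ nhds 0)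
    (θ : ℝ) : boundaryPoint A θ ∈ frontier A := by
  have hpos := gauge_pos_of_isCompact hA h0 (circlePoint_ne_zero θ)
  rw [← gauge_eq_one_iff_mem_frontier hc h0, boundaryPoint,
    gauge_smul_of_nonneg (inv_nonneg.2 hpos.le), smul_eq_mul, inv_mul_cancel₀ hpos.ne']

theorem exists_boundaryPoint_eq (hc : Convex ℝ A) (h0 : A ∈ nhds 0)
    {z : ℝ × ℝ} (hz : z ∈ frontier A) :
    ∃ θ ∈ Ioc (-Real.pi) Real.pi, boundaryPoint A θ = z := by
  have hz0 : z ≠ 0 := by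
    rintro rfl
    exact hz.2 (mem_interior_iff_mem_nhds.2 h0)
  obtain ⟨r, hr, θ, hθ, rfl⟩ := exists_eq_smul_circlePoint hz0
  refine ⟨θ, hθ, ?_⟩
  rw [← gauge_eq_one_iff_mem_frontier hc h0, gauge_smul_of_nonneg hr.le, smul_eq_mul] at hz
  rw [boundaryPoint, ← eq_inv_of_mul_eq_one_left hz]

theorem injOn_boundaryPoint (hA : IsCompact A) (h0 : A ∈ nhds 0) :
    InjOn (boundaryPoint A) (Ioc (-Real.pi) Real.pi) := by
  have harg : ∀ θ ∈ Ioc (-Real.pi) Real.pi,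
      Complex.arg ⟨(boundaryPoint A θ).1, (boundaryPoint A θ).2⟩ = θ := by
    intro θ hθ
    have hpos := inv_pos.2 (gauge_pos_of_isCompact hA h0 (circlePoint_ne_zero θ))
    have : (⟨(boundaryPoint A θ).1, (boundaryPoint A θ).2⟩ : ℂ) =
        ((gauge A (circlePoint θ))⁻¹ : ℝ) * (Complex.cos θ + Complex.sin θ * Complex.I) := by
      rw [← Complex.ofReal_cos, ← Complex.ofReal_sin]
      apply Complex.ext <;>
        simp [boundaryPoint, circlePoint, -Complex.ofReal_inv, -Complex.ofReal_cos,
          -Complex.ofReal_sin]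
    rw [this, Complex.arg_mul_cos_add_sin_mul_I hpos hθ]
  intro s hs t ht hst
  rw [← harg s hs, ← harg t ht, hst]

/-- Every interior point `m` of a planar convex body is the midpoint of a chord: if `g` is the gauge
of the body as seen from `m`, then `u ↦ g u - g (-u)` is continuous and odd on the unit circle, so it
has a zero. -/
theorem exists_chord_of_mem_interior (hA : IsCompact A) (hc : Convex ℝ A) {m : ℝ × ℝ}
    (hm : m ∈ interior A) : ∃ v ≠ 0, m + v ∈ frontier A ∧ m - v ∈ frontier A := by
  set S : Set (ℝ × ℝ) := Homeomorph.addLeft m ⁻¹' A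
  have hS : IsCompact S := (Homeomorph.addLeft m).isCompact_preimage.2 hA
  have hSc : Convex ℝ S := hc.translate_preimage_right m
  have hS0 : S ∈ nhds 0 := (Homeomorph.addLeft m).continuous.continuousAt.preimage_mem_nhds
    (by simpa using mem_interior_iff_mem_nhds.1 hm)
  set f : ℝ → ℝ := fun θ => gauge S (circlePoint θ) - gauge S (-circlePoint θ) with hf
  have hfc : Continuous f := by
    have := continuous_gauge hSc hS0
    have := continuous_circlePoint
    fun_prop
  have hfpi : f Real.pi = -f 0 := by
    have h1 : circlePoint Real.pi = -circlePoint 0 := by ext <;> simp [circlePoint]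
    simp [hf, h1]
  obtain ⟨θ, hθ⟩ : ∃ θ, f θ = 0 := by
    have := mem_range_of_exists_le_of_exists_ge hfc (c := 0)
    rcases le_total (f 0) 0 with h | h
    · exact this ⟨0, h⟩ ⟨Real.pi, by linarith⟩
    · exact this ⟨Real.pi, by linarith⟩ ⟨0, h⟩
  have hpos := gauge_pos_of_isCompact hS hS0 (circlePoint_ne_zero θ)
  set r := (gauge S (circlePoint θ))⁻¹ with hr
  have hr0 : 0 < r := inv_pos.2 hpos
  have hfr : frontier S = Homeomorph.addLeft m ⁻¹' frontier A :=
    ((Homeomorph.addLeft m).preimage_frontier A).symm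
  have h1 : r • circlePoint θ ∈ frontier S := by
    rw [← gauge_eq_one_iff_mem_frontier hSc hS0, gauge_smul_of_nonneg hr0.le, smul_eq_mul, hr,
      inv_mul_cancel₀ hpos.ne']
  have h2 : r • -circlePoint θ ∈ frontier S := by
    rw [← gauge_eq_one_iff_mem_frontier hSc hS0, gauge_smul_of_nonneg hr0.le, smul_eq_mul,
      ← sub_eq_zero.1 hθ, hr, inv_mul_cancel₀ hpos.ne']
  rw [hfr] at h1 h2
  refine ⟨r • circlePoint θ, smul_ne_zero hr0.ne' (circlePoint_ne_zero θ), h1, ?_⟩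
  simpa [sub_eq_add_neg] using h2

end Boundary

/-! ### Short chords of a strictly convex planar body -/

/-- The determinant of two plane vectors. The origin lies strictly to the left of the oriented line
from `x` to `y` exactly if `wedge x y` is positive. -/
def wedge (x y : ℝ × ℝ) : ℝ := x.1 * y.2 - x.2 * y.1

theorem exists_eq_smul_of_wedge_eq_zero {x v : ℝ × ℝ} (hv : v ≠ 0) (h : wedge x v = 0) :
    ∃ c : ℝ, x = c • v := by
  simp only [wedge] at h
  have hv' : v.1 ≠ 0 ∨ v.2 ≠ 0 := by
    by_contra! hne
    exact hv (Prod.ext hne.1 hne.2)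
  rcases hv' with h1 | h1
  · refine ⟨x.1 / v.1, Prod.ext ?_ ?_⟩ <;> simp only [Prod.smul_fst, Prod.smul_snd, smul_eq_mul] <;>
      field_simp
    linarith
  · refine ⟨x.2 / v.2, Prod.ext ?_ ?_⟩ <;> simp only [Prod.smul_fst, Prod.smul_snd, smul_eq_mul] <;>
      field_simp
    linarith

/-- On a line in direction `v`, let a strictly convex set contain a segment `[p, p + 2 κ v]` with
`κ ≥ 1`, and let `x` and `x + 2 v` be boundary points of the set. As a boundary point is never
strictly between two other points of the set, the two segments coincide. -/
theorem StrictConvex.eq_of_collinear_chord {E : Type*} [NormedAddCommGroup E] [NormedSpace ℝ E]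
    {A : Set E} (hA : StrictConvex ℝ A) {v p x : E} {κ c : ℝ} (hv : v ≠ 0) (hκ : 1 ≤ κ)
    (hp : p ∈ A) (hq : p + (2 * κ) • v ∈ A) (hx : x ∈ A) (hx' : x ∉ interior A)
    (hy : x + (2 : ℝ) • v ∈ A) (hy' : x + (2 : ℝ) • v ∉ interior A) (hc : x = p + c • v) :
    c = 0 ∧ κ = 1 := by
  have between : ∀ {r s t : ℝ}, r < s → s < t → p + r • v ∈ A → p + t • v ∈ A →
      p + s • v ∈ interior A := by
    intro r s t hrs hst hr ht
    have hne : p + r • v ≠ p + t • v := by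
      intro h
      exact (hrs.trans hst).ne (smul_left_injective ℝ hv (add_left_cancel h))
    refine hA.openSegment_subset hr ht hne
      ⟨(t - s) / (t - r), (s - r) / (t - r), div_pos (by linarith) (by linarith),
        div_pos (by linarith) (by linarith), ?_, ?_⟩
    · rw [← add_div, show t - s + (s - r) = t - r by ring, div_self (by linarith)]
    · have h0 : t - r ≠ 0 := by linarith
      have e1 : (t - s) / (t - r) = 1 - (s - r) / (t - r) := by field_simp; ring
      have e2 : s = r + (s - r) / (t - r) * (t - r) := by field_simp; ring
      conv_rhs => rw [e2]
      rw [e1]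
      module
  have hp0 : p + (0 : ℝ) • v ∈ A := by simpa using hp
  have e : x + (2 : ℝ) • v = p + (c + 2) • v := by rw [hc]; module
  rw [e] at hy hy'
  rw [hc] at hx hx'
  have hc0 : c = 0 := by
    rcases lt_trichotomy c 0 with h | h | h
    · exact absurd (between (by linarith : c < c + 2) (by linarith : c + 2 < 2 * κ) hx hq) hy'
    · exact h
    · exact absurd (between h (by linarith : c < c + 2) hp0 hy) hx'
  refine ⟨hc0, le_antisymm ?_ hκ⟩
  by_contra! h
  exact hy' (between (by linarith : 0 < c + 2) (by linarith : c + 2 < 2 * κ) hp0 hq)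

/-- Of two parallel chords with the same vector `2 v`, both passing the origin on the same side, the
one nearer to the origin lies in the trapezoid spanned by the other one and by the longer segment
`[-κ v, κ v]`, which is impossible in a strictly convex set unless the chords coincide. -/
theorem StrictConvex.eq_of_parallel_chords {A : Set (ℝ × ℝ)} (hA : StrictConvex ℝ A)
    {v x₁ x₂ : ℝ × ℝ} {κ : ℝ} (hκ : 1 < κ) (hκv : κ • v ∈ A) (hκv' : -(κ • v) ∈ A)
    (hx₁ : x₁ ∈ A) (hy₁ : x₁ + (2 : ℝ) • v ∈ A)
    (hx₂ : x₂ ∈ A) (hy₂ : x₂ + (2 : ℝ) • v ∈ A) (hx₂' : x₂ ∉ interior A)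
    (hy₂' : x₂ + (2 : ℝ) • v ∉ interior A) (h₂ : 0 < wedge x₂ v) (h₁₂ : wedge x₂ v ≤ wedge x₁ v) :
    x₁ = x₂ := by
  have hv : v ≠ 0 := by
    rintro rfl
    simp [wedge] at h₂
  have h₁ : 0 < wedge x₁ v := h₂.trans_le h₁₂
  -- `p` is the point of the segment from `x₁` to `-κ v` at the level of the second chord.
  set τ := 1 - wedge x₂ v / wedge x₁ v with hτ
  have hτ0 : 0 ≤ τ := by
    have := (div_le_one h₁).2 h₁₂
    linarith
  have hτ1 : τ ≤ 1 := by
    have : 0 < wedge x₂ v / wedge x₁ v := by positivity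
    linarith
  set p := (1 - τ) • x₁ + τ • -(κ • v) with hp_def
  have hp : p ∈ A := hA.convex hx₁ hκv' (by linarith) hτ0 (by ring)
  have hq : p + (2 * (1 + τ * (κ - 1))) • v ∈ A := by
    have : p + (2 * (1 + τ * (κ - 1))) • v = (1 - τ) • (x₁ + (2 : ℝ) • v) + τ • (κ • v) := by
      rw [hp_def]; module
    rw [this]
    exact hA.convex hy₁ hκv (by linarith) hτ0 (by ring)
  obtain ⟨c, hc⟩ : ∃ c : ℝ, x₂ - p = c • v := by
    refine exists_eq_smul_of_wedge_eq_zero hv ?_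
    have hlevel : wedge (x₂ - p) v = wedge x₂ v - (1 - τ) * wedge x₁ v := by
      simp only [wedge, hp_def, Prod.fst_sub, Prod.snd_sub, Prod.fst_add, Prod.snd_add,
        Prod.smul_fst, Prod.smul_snd, Prod.fst_neg, Prod.snd_neg, smul_eq_mul]
      ring
    rw [hlevel, hτ]
    field_simp
    ring
  have hx₂p : x₂ = p + c • v := by rw [← hc]; abel
  obtain ⟨rfl, hκ1⟩ := hA.eq_of_collinear_chord hv
    (by nlinarith : 1 ≤ 1 + τ * (κ - 1)) hp hq hx₂ hx₂' hy₂ hy₂' hx₂p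
  have hτz : τ = 0 := by
    have : τ * (κ - 1) = 0 := by linarith
    rcases mul_eq_zero.1 this with h | h
    · exact h
    · linarith
  rw [hx₂p, hp_def, hτz]
  module

/-- The points of a strictly convex planar body that are not the midpoint of a chord of `p`-length
`2 ρ` fill at most the area of the `p`-ball of radius `ρ`, if that body contains a larger `p`-ball
around the origin. Such a point is the midpoint of a chord of the body with both ends on the
boundary and of length less than `2 ρ`. Orient these chords so that the origin is on the left; then
a chord is determined by its vector, and passing from half-vectors to midpoints preserves area. -/
theorem volume_not_midpoint_le {A : Set (ℝ × ℝ)} (hA : IsCompact A) (hs : StrictConvex ℝ A)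
    (p : Seminorm ℝ (ℝ × ℝ)) (hp : Continuous p) {r₀ ρ : ℝ} (hρ : 0 < ρ) (hρr : ρ < r₀)
    (hball : ∀ z, p z ≤ r₀ → z ∈ A) :
    volume {m ∈ A | ∀ v, p v = ρ → ¬ (m + v ∈ A ∧ m - v ∈ A)} ≤ volume {v | p v < ρ} := by
  have hc : Convex ℝ A := hs.convex
  have hr₀ : 0 < r₀ := hρ.trans hρr
  have h0 : A ∈ nhds 0 := by
    refine Filter.mem_of_superset ((isOpen_lt hp continuous_const).mem_nhds
      (show p 0 < r₀ by simpa using hr₀)) fun z hz => hball z (le_of_lt hz)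
  have hfr : ∀ {z}, z ∈ frontier A → z ∈ A ∧ z ∉ interior A := fun hz =>
    ⟨hA.isClosed.frontier_subset hz, hz.2⟩
  -- A vector in the open `ρ`-ball stays in `A` when stretched by `κ > 1`: the chord through the
  -- origin in its direction is longer.
  set κ := r₀ / ρ with hκ_def
  have hκ : 1 < κ := (one_lt_div hρ).2 hρr
  have hκA : ∀ v, p v < ρ → κ • v ∈ A ∧ -(κ • v) ∈ A := by
    intro v hv
    have : p (κ • v) ≤ r₀ := by
      rw [map_smul_eq_mul, Real.norm_of_nonneg (by positivity), hκ_def, div_mul_eq_mul_div,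
        div_le_iff₀ hρ]
      gcongr
    exact ⟨hball _ this, hball _ (by rwa [map_neg_eq_map])⟩
  obtain ⟨C, hC⟩ := exists_lipschitzWith_boundaryPoint hA hc h0
  set x := boundaryPoint A with hx_def
  have hxA : ∀ θ, x θ ∈ A ∧ x θ ∉ interior A := fun θ =>
    hfr (boundaryPoint_mem_frontier hA hc h0 θ)
  set I : Set ℝ := Ioc (-Real.pi) Real.pi
  set P : Set (ℝ × ℝ) := (I ×ˢ I) ∩
    ({z | p ((1 / 2 : ℝ) • (x z.2 - x z.1)) < ρ} ∩ {z | 0 < wedge (x z.1) (x z.2)})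
  have hxc : Continuous x := hC.continuous
  have hP : MeasurableSet P := by
    refine (measurableSet_Ioc.prod measurableSet_Ioc).inter (MeasurableSet.inter ?_ ?_)
    · exact (isOpen_lt (by fun_prop) continuous_const).measurableSet
    · exact (isOpen_lt continuous_const (by unfold wedge; fun_prop)).measurableSet
  have hwedge : ∀ y v : ℝ × ℝ, wedge y (y + (2 : ℝ) • v) = 2 * wedge y v := by
    intro y v
    simp only [wedge, Prod.fst_add, Prod.snd_add, Prod.smul_fst, Prod.smul_snd, smul_eq_mul]
    ring
  have hinj : InjOn (fun z : ℝ × ℝ => (1 / 2 : ℝ) • (x z.2 - x z.1)) P := by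
    rintro ⟨s₁, t₁⟩ ⟨⟨hs₁, ht₁⟩, hv₁, hw₁⟩ ⟨s₂, t₂⟩ ⟨⟨hs₂, ht₂⟩, hv₂, hw₂⟩ hEq
    simp only [mem_ofPred_eq] at hv₁ hv₂ hw₁ hw₂ hEq hs₁ ht₁ hs₂ ht₂
    set v := (1 / 2 : ℝ) • (x t₁ - x s₁) with hv
    have ht₁v : x t₁ = x s₁ + (2 : ℝ) • v := by rw [hv]; module
    have ht₂v : x t₂ = x s₂ + (2 : ℝ) • v := by rw [hEq]; module
    obtain ⟨hk, hk'⟩ := hκA v hv₁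
    have hA₁ := hxA t₁
    have hA₂ := hxA t₂
    rw [ht₁v] at hA₁ hw₁
    rw [ht₂v] at hA₂ hw₂
    rw [hwedge] at hw₁ hw₂
    have hxs : x s₁ = x s₂ := by
      rcases le_total (wedge (x s₂) v) (wedge (x s₁) v) with h | h
      · exact hs.eq_of_parallel_chords hκ hk hk' (hxA s₁).1 hA₁.1 (hxA s₂).1 hA₂.1 (hxA s₂).2
          hA₂.2 (by linarith) h
      · exact (hs.eq_of_parallel_chords hκ hk hk' (hxA s₂).1 hA₂.1 (hxA s₁).1 hA₁.1 (hxA s₁).2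
          hA₁.2 (by linarith) h).symm
    have hxt : x t₁ = x t₂ := by rw [ht₁v, ht₂v, hxs]
    exact Prod.ext (injOn_boundaryPoint hA h0 hs₁ hs₂ hxs) (injOn_boundaryPoint hA h0 ht₁ ht₂ hxt)
  set N : Set (ℝ × ℝ) := {m ∈ A | ∀ v, p v = ρ → ¬ (m + v ∈ A ∧ m - v ∈ A)}
  have hcover : N ∩ interior A ⊆ (fun z : ℝ × ℝ => (1 / 2 : ℝ) • (x z.1 + x z.2)) '' P := by
    rintro m ⟨⟨hmA, hmN⟩, hmi⟩
    obtain ⟨v, hv0, hpf, hmf⟩ := exists_chord_of_mem_interior hA hc hmi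
    have hvρ : p v < ρ := by
      by_contra! hle
      have hpv : 0 < p v := hρ.trans_le hle
      have hr1 : ρ / p v ≤ 1 := (div_le_one hpv).2 hle
      have hr0 : 0 ≤ ρ / p v := by positivity
      refine hmN ((ρ / p v) • v) ?_ ⟨?_, ?_⟩
      · rw [map_smul_eq_mul, Real.norm_of_nonneg hr0, div_mul_cancel₀ _ hpv.ne']
      · convert hc hmA (hfr hpf).1 (sub_nonneg.2 hr1) hr0 (by ring) using 1
        module
      · convert hc hmA (hfr hmf).1 (sub_nonneg.2 hr1) hr0 (by ring) using 1
        module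
    -- The chord misses the origin, as a chord through it would contain `[-κ v, κ v]`.
    have hw : wedge m v ≠ 0 := by
      intro h
      obtain ⟨c, hcm⟩ := exists_eq_smul_of_wedge_eq_zero hv0 h
      obtain ⟨hk, hk'⟩ := hκA v hvρ
      have hend : m - v + (2 : ℝ) • v = m + v := by module
      have := (hs.eq_of_collinear_chord (x := m - v) (c := c - 1 + κ) hv0 hκ.le hk'
        (by convert hk using 1; module) (hfr hmf).1 (hfr hmf).2 (by rw [hend]; exact (hfr hpf).1)
        (by rw [hend]; exact (hfr hpf).2) (by rw [hcm]; module)).2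
      linarith
    obtain ⟨s, hs, hxs⟩ := exists_boundaryPoint_eq hc h0 hmf
    obtain ⟨t, ht, hxt⟩ := exists_boundaryPoint_eq hc h0 hpf
    rw [← hx_def] at hxs hxt
    rcases lt_or_gt_of_ne hw with h | h
    · refine ⟨(t, s), ⟨⟨ht, hs⟩, ?_, ?_⟩, ?_⟩
      · have : (1 / 2 : ℝ) • (m - v - (m + v)) = -v := by module
        simpa only [mem_ofPred_eq, hxs, hxt, this, map_neg_eq_map] using hvρ
      · have : wedge (m + v) (m - v) = -2 * wedge m v := by
          simp only [wedge, Prod.fst_add, Prod.snd_add, Prod.fst_sub, Prod.snd_sub]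
          ring
        simp only [mem_ofPred_eq, hxs, hxt, this]
        linarith
      · simp only [hxs, hxt]
        module
    · refine ⟨(s, t), ⟨⟨hs, ht⟩, ?_, ?_⟩, ?_⟩
      · have : (1 / 2 : ℝ) • (m + v - (m - v)) = v := by module
        simpa only [mem_ofPred_eq, hxs, hxt, this] using hvρ
      · have : wedge (m - v) (m + v) = 2 * wedge m v := by
          simp only [wedge, Prod.fst_add, Prod.snd_add, Prod.fst_sub, Prod.snd_sub]
          ring
        simp only [mem_ofPred_eq, hxs, hxt, this]
        linarith
      · simp only [hxs, hxt]
        module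
  calc volume N ≤ volume (N ∩ interior A ∪ frontier A) := by
        refine measure_mono fun m hm => ?_
        by_cases h : m ∈ interior A
        · exact Or.inl ⟨hm, h⟩
        · exact Or.inr ⟨subset_closure hm.1, h⟩
    _ ≤ volume (N ∩ interior A) + volume (frontier A) := measure_union_le _ _
    _ = volume (N ∩ interior A) := by rw [hc.addHaar_frontier volume, add_zero]
    _ ≤ _ := measure_mono hcover
    _ ≤ _ := volume_image_midpoint_le hC hP hinj
    _ ≤ volume {v | p v < ρ} := by
        refine measure_mono ?_
        rintro _ ⟨z, hz, rfl⟩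
        exact hz.2.1

/-! ### The planar inequality -/

/-- The inequality in a plane with a seminorm `p` whose unit ball is bounded (so `p` is
a norm). The body `K` of all centres of `p`-balls of radius `δ` in `A` has area at least
`(1 - ε²) |A|` by `volume_not_midpoint_le`. With `B` the unit ball, the Brunn–Minkowski inequality
for `K + δ B ⊆ A` and for `A - A ⊆ B` yields
`√(1 - ε²) √|A| + 2 δ √|A| ≤ √|K| + δ √|B| ≤ √|A|`. -/
theorem le_of_midpoint_add_ball_mem {A : Set (ℝ × ℝ)} (hA : IsCompact A) (hs : StrictConvex ℝ A)
    (p : Seminorm ℝ (ℝ × ℝ)) (hp : Continuous p) (hpb : Bornology.IsBounded {z | p z ≤ 1})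
    {r₀ ε δ : ℝ} (hr₀ : 0 < r₀) (hball : ∀ z, p z ≤ r₀ → z ∈ A)
    (hdiam : ∀ x ∈ A, ∀ y ∈ A, p (x - y) ≤ 1) (hε : 0 < ε) (hε1 : ε < 1) (hδ : 0 ≤ δ)
    (hmid : ∀ x ∈ A, ∀ y ∈ A, p (x - y) = 2 * r₀ * ε → ∀ z, p z ≤ δ →
      (1 / 2 : ℝ) • (x + y) + z ∈ A) :
    δ ≤ 1 / 2 * (1 - √(1 - ε ^ 2)) := by
  set B : Set (ℝ × ℝ) := {z | p z ≤ 1} with hB_def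
  have hB : IsCompact B :=
    Metric.isCompact_of_isClosed_isBounded (isClosed_le hp continuous_const) hpb
  have hfin : ∀ {S : Set (ℝ × ℝ)}, IsCompact S → volume S ≠ ∞ := fun hS => hS.measure_lt_top.ne
  have hB0 : 0 < volume B := by
    refine Measure.measure_pos_of_mem_nhds volume (x := 0) (Filter.mem_of_superset
      ((isOpen_lt hp continuous_const).mem_nhds (show p 0 < 1 by simp)) fun z hz => show p z ≤ 1 from le_of_lt hz)
  have hvB : 0 < volume.real B := ENNReal.toReal_pos hB0.ne' (hfin hB)
  have hsmul : ∀ {r : ℝ}, 0 ≤ r → volume.real (r • B) = r ^ 2 * volume.real B := by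
    intro r hr
    simp [Measure.real, Measure.addHaar_smul, sq_nonneg]
  have hsub : ∀ {r : ℝ} {z : ℝ × ℝ}, 0 < r → p z ≤ r → z ∈ r • B := by
    intro r z hr hz
    refine (mem_smul_set_iff_inv_smul_mem₀ hr.ne' _ _).2 ?_
    rw [hB_def, mem_ofPred_eq, map_smul_eq_mul, Real.norm_of_nonneg (inv_nonneg.2 hr.le),
      inv_mul_le_iff₀ hr]
    simpa using hz
  have hsub' : ∀ {r : ℝ} {z : ℝ × ℝ}, 0 ≤ r → z ∈ r • B → p z ≤ r := by
    rintro r _ hr ⟨z, hz, rfl⟩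
    rw [map_smul_eq_mul, Real.norm_of_nonneg hr]
    exact mul_le_of_le_one_right hr hz
  have hrB : r₀ ^ 2 * volume.real B ≤ volume.real A := by
    rw [← hsmul hr₀.le]
    exact measureReal_mono (fun z hz => hball z (hsub' hr₀.le hz)) (hfin hA)
  have hvA : 0 < volume.real A := lt_of_lt_of_le (by positivity) hrB
  have hA0 : 0 < volume A := (ENNReal.toReal_pos_iff.1 hvA).1
  set K : Set (ℝ × ℝ) := A ∩ ⋂ z ∈ {z | p z ≤ δ}, (fun m => m + z) ⁻¹' A
  have hK : IsCompact K := hA.inter_right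
    (isClosed_biInter fun z _ => hA.isClosed.preimage (continuous_add_const z))
  set ρ := r₀ * ε with hρ_def
  have hρ : 0 < ρ := by positivity
  have hρr : ρ < r₀ := by nlinarith
  have hN := volume_not_midpoint_le hA hs p hp hρ hρr hball
  set N : Set (ℝ × ℝ) := {m ∈ A | ∀ v, p v = ρ → ¬ (m + v ∈ A ∧ m - v ∈ A)}
  have hAK : A ⊆ N ∪ K := by
    intro m hm
    by_cases hmN : m ∈ N
    · exact Or.inl hmN
    · refine Or.inr ⟨hm, ?_⟩
      have : ∃ v, p v = ρ ∧ m + v ∈ A ∧ m - v ∈ A := by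
        by_contra! h
        exact hmN ⟨hm, fun v hv hv' => h v hv hv'.1 hv'.2⟩
      obtain ⟨v, hv, h1, h2⟩ := this
      simp only [mem_iInter, mem_ofPred_eq, mem_preimage]
      intro z hz
      have e1 : m + v - (m - v) = (2 : ℝ) • v := by module
      have e2 : (1 / 2 : ℝ) • (m + v + (m - v)) = m := by module
      have := hmid _ h1 _ h2 (by rw [e1, map_smul_eq_mul, hv, hρ_def]; norm_num; ring) z hz
      rwa [e2] at this
  have hNle : volume N ≤ volume (ρ • B) :=
    hN.trans (measure_mono fun z hz => hsub hρ (le_of_lt hz))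
  have hρBfin := hfin (hB.smul ρ)
  have harea : volume.real A ≤ ρ ^ 2 * volume.real B + volume.real K := by
    rw [← hsmul hρ.le]
    have h1 : volume A ≤ volume (ρ • B) + volume K :=
      (measure_mono hAK).trans ((measure_union_le _ _).trans (by gcongr))
    have h2 := ENNReal.toReal_mono (ENNReal.add_ne_top.2 ⟨hρBfin, hfin hK⟩) h1
    rwa [ENNReal.toReal_add hρBfin (hfin hK)] at h2
  have hε2 : 0 < 1 - ε ^ 2 := by nlinarith
  have hKA : (1 - ε ^ 2) * volume.real A ≤ volume.real K := by
    have : ρ ^ 2 * volume.real B = ε ^ 2 * (r₀ ^ 2 * volume.real B) := by rw [hρ_def]; ring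
    nlinarith [sq_nonneg ε]
  have hK0 : 0 < volume K := (ENNReal.toReal_pos_iff.1 (lt_of_lt_of_le (by positivity) hKA)).1
  -- The form of the Brunn–Minkowski inequality used here needs `δ B` to have positive area.
  rcases hδ.eq_or_lt with rfl | hδ0
  · have : √(1 - ε ^ 2) ≤ 1 := Real.sqrt_le_one.2 (by nlinarith [sq_nonneg ε])
    linarith
  have hAA : 2 * √(volume.real A) ≤ √(volume.real B) := by
    have hneg : volume.real (-A) = volume.real A := by simp [Measure.real]
    have h1 := sqrt_volume_add_sqrt_volume_le hA hA.neg hA0 (by rwa [Measure.measure_neg])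
    have h2 : volume.real (A + -A) ≤ volume.real B := by
      refine measureReal_mono ?_ (hfin hB)
      rintro _ ⟨x, hx, y, hy, rfl⟩
      have := hdiam x hx (-y) hy
      rwa [sub_neg_eq_add] at this
    rw [hneg] at h1
    linarith [Real.sqrt_le_sqrt h2]
  have hBM : √(volume.real K) + δ * √(volume.real B) ≤ √(volume.real A) := by
    have hδB0 : 0 < volume (δ • B) :=
      (ENNReal.toReal_pos_iff.1 (show 0 < volume.real (δ • B) by
        rw [hsmul hδ]; positivity)).1
    have h1 := sqrt_volume_add_sqrt_volume_le hK (hB.smul δ) hK0 hδB0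
    rw [hsmul hδ, Real.sqrt_mul (sq_nonneg δ), Real.sqrt_sq hδ] at h1
    refine h1.trans (Real.sqrt_le_sqrt (measureReal_mono ?_ (hfin hA)))
    rintro _ ⟨m, hm, z, hz, rfl⟩
    have := hm.2
    simp only [mem_iInter, mem_ofPred_eq, mem_preimage] at this
    exact this z (hsub' hδ hz)
  have hsK : √(1 - ε ^ 2) * √(volume.real A) ≤ √(volume.real K) := by
    rw [← Real.sqrt_mul hε2.le]
    exact Real.sqrt_le_sqrt hKA
  have hsA : 0 < √(volume.real A) := Real.sqrt_pos.2 hvA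
  have hfinal : (√(1 - ε ^ 2) + 2 * δ) * √(volume.real A) ≤ 1 * √(volume.real A) := by
    nlinarith [mul_le_mul_of_nonneg_left hAA hδ]
  have := le_of_mul_le_mul_right hfinal hsA
  linarith

/-! ### The upper bound for the modulus of convexity -/

section Modulus

variable {E : Type*} [NormedAddCommGroup E] [NormedSpace ℝ E]

/-- Shrinking a segment towards one of its points `z` makes `z` the midpoint of a short chord, so
the modulus at small arguments already puts `z` in the interior. -/
theorem IsUniformlyConvexSet.strictConvex {A : Set E} (hA : IsUniformlyConvexSet A) :
    StrictConvex ℝ A := by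
  rw [strictConvex_iff_openSegment_subset]
  rintro x hx y hy hxy z ⟨s, t, hs, ht, hst, rfl⟩
  have hn : 0 < ‖x - y‖ := norm_pos_iff.2 (sub_ne_zero.2 hxy)
  set η := min s t / 2 with hη
  have hη0 : 0 < η := by positivity
  have hηs : η < s := by have := min_le_left s t; have := lt_min hs ht; linarith
  have hηt : η < t := by have := min_le_right s t; have := lt_min hs ht; linarith
  set h := η • (x - y) with h_def
  have h1 : s • x + t • y + h ∈ A := by
    convert hA.convex hx hy (by linarith : 0 ≤ s + η) (by linarith : 0 ≤ t - η) (by linarith)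
      using 1
    rw [h_def]; module
  have h2 : s • x + t • y - h ∈ A := by
    convert hA.convex hx hy (by linarith : 0 ≤ s - η) (by linarith : 0 ≤ t + η) (by linarith)
      using 1
    rw [h_def]; module
  have hnorm : ‖(s • x + t • y + h) - (s • x + t • y - h)‖ = 2 * η * ‖x - y‖ := by
    have : (s • x + t • y + h) - (s • x + t • y - h) = (2 * η) • (x - y) := by
      rw [h_def]; module
    rw [this, norm_smul, Real.norm_of_nonneg (by positivity)]
  have hlt : ENNReal.ofReal (2 * η * ‖x - y‖) < Metric.ediam A := by
    refine lt_of_lt_of_le ?_ (Metric.edist_le_ediam_of_mem hx hy)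
    rw [edist_dist, dist_eq_norm, ENNReal.ofReal_lt_ofReal_iff hn]
    nlinarith
  obtain ⟨_, ⟨δ, ⟨-, hδ⟩, rfl⟩, hpos⟩ :=
    lt_sSup_iff.1 (hA.modulus_pos _ (by positivity) hlt)
  have hδ0 : 0 < δ := ENNReal.ofReal_pos.1 hpos
  have hmid : (1 / 2 : ℝ) • ((s • x + t • y + h) + (s • x + t • y - h)) = s • x + t • y := by
    module
  have hsub := hδ _ h1 _ h2 hnorm
  rw [hmid] at hsub
  exact mem_interior_iff_mem_nhds.2
    (Filter.mem_of_superset (Metric.closedBall_mem_nhds _ hδ0) hsub)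

theorem exists_injective_linearMap_of_two_le_rank (h : 2 ≤ Module.rank ℝ E) :
    ∃ f : ℝ × ℝ →ₗ[ℝ] E, Function.Injective f := by
  have h1 : 1 < Module.rank ℝ E := lt_of_lt_of_le (by norm_num) h
  have : Nontrivial E := rank_pos_iff_nontrivial.1 (zero_lt_one.trans h1)
  obtain ⟨x, hx⟩ := exists_ne (0 : E)
  obtain ⟨y, hxy⟩ := exists_linearIndependent_pair_of_one_lt_rank h1 hx
  rw [LinearIndependent.pair_iff] at hxy
  refine ⟨(LinearMap.toSpanSingleton ℝ E x).coprod (LinearMap.toSpanSingleton ℝ E y), ?_⟩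
  rw [injective_iff_map_eq_zero]
  rintro ⟨s, t⟩ hst
  obtain ⟨rfl, rfl⟩ := hxy s t (by simpa using hst)
  rfl

/-- The planar inequality, applied to the section of `A` by a plane through the centre `a`. -/
theorem modulusOfConvexity_le (hE : 2 ≤ Module.rank ℝ E) {A : Set E}
    (hA : IsUniformlyConvexSet A) (hdiam : Metric.ediam A = 1) {r₀ : ℝ} {a : E} (hr₀ : 0 < r₀)
    (hball : Metric.closedBall a r₀ ⊆ A) {ε : ℝ} (hε : 0 < ε) (hε1 : ε < 1) :
    modulusOfConvexity A (2 * r₀ * ε) ≤ ENNReal.ofReal (1 / 2 * (1 - √(1 - ε ^ 2))) := by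
  obtain ⟨f, hf⟩ := exists_injective_linearMap_of_two_le_rank hE
  have hfc : Continuous f := f.continuous_of_finiteDimensional
  obtain ⟨C, -, hC⟩ := f.exists_antilipschitzWith (LinearMap.ker_eq_bot.2 hf)
  set p : Seminorm ℝ (ℝ × ℝ) := (normSeminorm ℝ E).comp f
  have hpf : ∀ z, p z = ‖f z‖ := fun z => rfl
  have hp : Continuous p := hfc.norm
  have hpb : Bornology.IsBounded {z | p z ≤ 1} := by
    refine (hC.isBounded_preimage (Metric.isBounded_closedBall (x := (0 : E)) (r := 1))).subset
      fun z hz => ?_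
    rw [mem_preimage, mem_closedBall_zero_iff, ← hpf]
    exact hz
  set A' : Set (ℝ × ℝ) := f ⁻¹' ((fun x => x + a) ⁻¹' A)
  have hmem : ∀ z, z ∈ A' ↔ f z + a ∈ A := fun z => Iff.rfl
  have hdist : ∀ x ∈ A, ∀ y ∈ A, ‖x - y‖ ≤ 1 := by
    intro x hx y hy
    have := Metric.edist_le_ediam_of_mem hx hy
    rwa [hdiam, edist_dist, dist_eq_norm, ENNReal.ofReal_le_one] at this
  have haA : a ∈ A := hball (Metric.mem_closedBall_self hr₀.le)
  have hA' : IsCompact A' := by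
    refine Metric.isCompact_of_isClosed_isBounded
      ((hA.isClosed.preimage (continuous_add_const a)).preimage hfc) (hpb.subset fun z hz => ?_)
    have := hdist _ hz a haA
    rwa [add_sub_cancel_right] at this
  have hs : StrictConvex ℝ A' := (hA.strictConvex.preimage_add_left a).linear_preimage f hfc hf
  refine sSup_le ?_
  rintro _ ⟨δ, ⟨hδ, hδA⟩, rfl⟩
  refine ENNReal.ofReal_le_ofReal (le_of_midpoint_add_ball_mem hA' hs p hp hpb hr₀ ?_ ?_ hε hε1 hδ
    ?_)
  · intro z hz
    refine hball ?_
    rwa [mem_closedBall_iff_norm, add_sub_cancel_right]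
  · intro x hx y hy
    have := hdist _ hx _ hy
    rwa [add_sub_add_right_eq_sub, ← map_sub] at this
  · intro x hx y hy hxy z hz
    have hd : ‖f x + a - (f y + a)‖ = 2 * r₀ * ε := by
      rw [add_sub_add_right_eq_sub, ← map_sub]
      exact hxy
    refine (hmem _).2 (hδA _ hx _ hy hd ?_)
    rw [mem_closedBall_iff_norm]
    have : f ((1 / 2 : ℝ) • (x + y) + z) + a - (1 / 2 : ℝ) • (f x + a + (f y + a)) = f z := by
      rw [map_add, map_smul, map_add]
      module
    rw [this]
    exact hz

end Modulus

/-! ### Euclidean balls -/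

section Euclidean

variable {H : Type*} [NormedAddCommGroup H] [InnerProductSpace ℝ H]

/-- The parallelogram law bounds the distance of the midpoint from the centre. -/
theorem ofReal_le_modulusOfConvexity_closedBall (c : H) (ε : ℝ) :
    ENNReal.ofReal (1 / 2 * (1 - √(1 - ε ^ 2))) ≤
      modulusOfConvexity (Metric.closedBall c (1 / 2)) ε := by
  refine le_sSup ⟨_, ⟨?_, ?_⟩, rfl⟩
  · have : √(1 - ε ^ 2) ≤ 1 := Real.sqrt_le_one.2 (by nlinarith [sq_nonneg ε])
    linarith
  · intro x hx y hy hxy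
    refine Metric.closedBall_subset_closedBall' ?_
    rw [mem_closedBall_iff_norm] at hx hy
    rw [dist_eq_norm]
    have hpar := parallelogram_law_with_norm ℝ (x - c) (y - c)
    have e1 : x - c + (y - c) = (2 : ℝ) • ((1 / 2 : ℝ) • (x + y) - c) := by module
    have e2 : x - c - (y - c) = x - y := by abel
    rw [e1, e2, hxy, norm_smul, Real.norm_ofNat] at hpar
    have hle : ‖(1 / 2 : ℝ) • (x + y) - c‖ ≤ √(1 - ε ^ 2) / 2 := by
      rw [le_div_iff₀ two_pos]
      refine Real.le_sqrt_of_sq_le ?_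
      nlinarith [norm_nonneg (x - c), norm_nonneg (y - c)]
    linarith

theorem ediam_closedBall_one_half [Nontrivial H] (c : H) :
    Metric.ediam (Metric.closedBall c (1 / 2)) = 1 := by
  have h := Metric.diam_closedBall_eq c (by norm_num : (0 : ℝ) ≤ 1 / 2)
  rw [Metric.diam] at h
  norm_num at h
  exact (ENNReal.toReal_eq_one_iff _).1 h

theorem isUniformlyConvexSet_closedBall_one_half [Nontrivial H] (c : H) :
    IsUniformlyConvexSet (Metric.closedBall c (1 / 2)) where
  isClosed := Metric.isClosed_closedBall
  convex := convex_closedBall c _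
  modulus_pos ε hε hlt := by
    rw [ediam_closedBall_one_half, ENNReal.ofReal_lt_one] at hlt
    refine lt_of_lt_of_le (ENNReal.ofReal_pos.2 ?_)
      (ofReal_le_modulusOfConvexity_closedBall c ε)
    have : √(1 - ε ^ 2) < 1 := (Real.sqrt_lt' one_pos).2 (by nlinarith)
    linarith


end Euclidean

theorem theorem2p2 :
    (∀ (E : Type*) [NormedAddCommGroup E] [NormedSpace ℝ E] [CompleteSpace E],
      2 ≤ Module.rank ℝ E →
      ∀ A : Set E, IsUniformlyConvexSet A → Metric.ediam A = 1 →
      ∀ (r₀ : ℝ) (a : E), 0 < r₀ → Metric.closedBall a r₀ ⊆ A →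
      ∀ ε : ℝ, 0 < ε → ε < 1 →
        modulusOfConvexity A (2 * r₀ * ε) ≤
          ENNReal.ofReal (1 / 2 * (1 - Real.sqrt (1 - ε ^ 2)))) ∧
    (∀ (H : Type*) [NormedAddCommGroup H] [InnerProductSpace ℝ H],
      2 ≤ Module.rank ℝ H →
      ∀ c : H, IsUniformlyConvexSet (Metric.closedBall c (1 / 2)) ∧
        Metric.ediam (Metric.closedBall c (1 / 2)) = 1 ∧
        ∀ ε : ℝ, 0 < ε → ε < 1 →
          modulusOfConvexity (Metric.closedBall c (1 / 2)) (2 * (1 / 2) * ε) =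
            ENNReal.ofReal (1 / 2 * (1 - Real.sqrt (1 - ε ^ 2)))) := by
  refine ⟨fun E _ _ _ hE A hA hdiam r₀ a hr₀ hball ε hε hε1 =>
    modulusOfConvexity_le hE hA hdiam hr₀ hball hε hε1, fun H _ _ hH c => ?_⟩
  have : Nontrivial H := rank_pos_iff_nontrivial.1 (lt_of_lt_of_le (by norm_num) hH)
  have hA := isUniformlyConvexSet_closedBall_one_half c
  have hdiam := ediam_closedBall_one_half c
  refine ⟨hA, hdiam, fun ε hε hε1 => le_antisymm
    (modulusOfConvexity_le hH hA hdiam (by norm_num) subset_rfl hε hε1) ?_⟩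
  rw [show 2 * (1 / 2) * ε = ε by ring]
  exact ofReal_le_modulusOfConvexity_closedBall c ε
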